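/- **Theorem 4.1 (Grace–Walsh–Szegő), together with Lemma 4.2.** Let $m\ge 0$ be an integer and let $f=\sum_{j=0}^m a_j x^j\in\mathbb{C}[x]$ be a polynomial of degree at most $m$. Let $$\mathrm{Pol}_m f=\sum_{j=0}^m a_j\binom{m}{j}^{-1}e_j(x_1,\dots,x_m)\in\mathbb{C}[x_1,\dots,x_m]$$ be its $m$-th polarization, where $e_j(x_1,\dots,x_m)=\sum_{1\le i_1<\cdots<i_j\le m}x_{i_1}\cdots x_{i_j}$ is the $j$-th elementary symmetric polynomial. A *circular region* is a subset of $\mathbb{C}$ that is an open or closed disc of positive radius, the open or closed exterior of a circle of positive radius (that is, $\{z:|z-c|>r\}$ or $\{z:|z-c|\ge r\}$ with $c\in\mathbb{C}$, $r>0$), or an open or closed half-plane. A polynomial in $\mathbb{C}[x_1,\dots,x_n]$ is *stable* if it is identically zero or does not vanish at any point $(z_1,\dots,z_n)$ with $\operatorname{Im} z_i>0$ for all $i$. 1. Let $\mathcal{A}$ be a circular region. If $\deg f=m$ or $\mathcal{A}$ is convex, then for every $\mathbf{z}=(z_1,\dots,z_m)\in\mathcal{A}^m$ there exists $w\in\mathcal{A}$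 such that $\mathrm{Pol}_m f(z_1,\dots,z_m)=f(w)$. 2. $\mathrm{Pol}_m f$ is stable if and only if $f$ is stable. -/

import Mathlib

namespace GWS

/-- A circular region: an open or closed disc, the open or closed exterior of a circle,
or an open or closed half-plane. The bounding circle has positive radius. -/
def IsCircularRegion (A : Set ℂ) : Prop :=
  (∃ (c : ℂ) (r : ℝ), 0 < r ∧
    (A = {z | ‖z - c‖ < r} ∨ A = {z | ‖z - c‖ ≤ r} ∨
      A = {z | r < ‖z - c‖} ∨ A = {z | r ≤ ‖z - c‖})) ∨
  (∃ (w : ℂ) (t : ℝ), w ≠ 0 ∧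
    (A = {z | t < (w * z).re} ∨ A = {z | t ≤ (w * z).re}))

/-- The `m`-th polarization of a univariate polynomial of degree at most `m`: the image under
the linear map sending `x ^ j` to `e_j(x_1, …, x_m) / (m choose j)` for `0 ≤ j ≤ m`. -/
noncomputable def polarization (m : ℕ) (f : Polynomial ℂ) : MvPolynomial (Fin m) ℂ :=
  ∑ j ∈ Finset.range (m + 1),
    MvPolynomial.C (f.coeff j * ((m.choose j : ℂ))⁻¹) * MvPolynomial.esymm (Fin m) ℂ j

/-- A univariate polynomial is stable if it is identically zero or has no zero in the open
upper half-plane. -/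
def IsStable (f : Polynomial ℂ) : Prop :=
  f = 0 ∨ ∀ z : ℂ, 0 < z.im → f.eval z ≠ 0

/-- A multivariate polynomial is stable if it is identically zero or does not vanish at any
point all of whose coordinates lie in the open upper half-plane. -/
def IsMvStable {σ : Type*} (F : MvPolynomial σ ℂ) : Prop :=
  F = 0 ∨ ∀ z : σ → ℂ, (∀ i, 0 < (z i).im) → MvPolynomial.eval z F ≠ 0

end GWS

namespace GWS

open Polynomial

/-! Subtracting the value `b` of the polarization from `f` reduces the claim to Grace's theorem: if
`g` has no zero in `A`, its polarization has none in `A^m`. Fixing one variable at `ζ` turns the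
polarization of `g` into that of its polar derivative (`eval_polarization_cons`), so induction works
once the polar derivative has no zero in `A`. This is Laguerre's theorem: a zero at `x ∈ A` would
make `(x - ζ)⁻¹` the mean of the `(x - α)⁻¹` over the zeros `α`, with zeros at infinity contributing
`0`; but inversion at `x` carries the complement of `A` to a convex set missing `(x - ζ)⁻¹`. For
discs and half-planes infinity counts as outside `A`, so the degree may drop. For exteriors it must
stay exact. Stability is the case of the upper half-plane, with the diagonal giving the converse. -/

/-- The arithmetic mean of finitely many points of a convex set lies in the set. -/
theorem _root_.Convex.multiset_average_mem {K : Set ℂ} (hK : Convex ℝ K) {s : Multiset ℂ}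
    (hs : s ≠ 0) (h : ∀ u ∈ s, u ∈ K) : (s.card : ℂ)⁻¹ * s.sum ∈ K := by
  induction s using Multiset.induction with
  | empty => exact absurd rfl hs
  | cons a s ih =>
    rcases eq_or_ne s 0 with rfl | hs0
    · simpa using h a (by simp)
    · have ha : a ∈ K := h a (by simp)
      have hm := ih hs0 fun u hu => h u (Multiset.mem_cons_of_mem hu)
      have hn : (0 : ℝ) < s.card := by exact_mod_cast Multiset.card_pos.mpr hs0
      have hc : (s.card : ℂ) ≠ 0 := by exact_mod_cast hn.ne'
      have hc' : (s.card : ℂ) + 1 ≠ 0 := by exact_mod_cast (by positivity : (s.card : ℝ) + 1 ≠ 0)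
      have := hK ha hm (a := ((s.card : ℝ) + 1)⁻¹) (b := s.card * ((s.card : ℝ) + 1)⁻¹)
        (by positivity) (by positivity) (by field_simp; ring)
      convert this using 1
      simp only [Multiset.card_cons, Multiset.sum_cons, Complex.real_smul]
      push_cast
      field_simp

/-! ### Polar derivatives and the recursion for polarizations -/

/-- The normalized polar derivative of `g`, viewed as a polynomial of formal degree `m + 1`,
with respect to the point `ζ`. -/
noncomputable def polarDerivative (m : ℕ) (ζ : ℂ) (g : ℂ[X]) : ℂ[X] :=
  g + C ((m + 1 : ℂ)⁻¹) * ((C ζ - X) * derivative g)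

theorem coeff_polarDerivative (m : ℕ) (ζ : ℂ) (g : ℂ[X]) (j : ℕ) :
    (polarDerivative m ζ g).coeff j =
      g.coeff j + (m + 1 : ℂ)⁻¹ * (ζ * ((j + 1) * g.coeff (j + 1)) - j * g.coeff j) := by
  cases j with
  | zero => simp [polarDerivative, sub_mul, coeff_derivative]
  | succ j =>
    simp only [polarDerivative, sub_mul, coeff_add, coeff_C_mul, coeff_sub, coeff_derivative,
      coeff_X_mul]
    push_cast
    ring

theorem eval_polarDerivative (m : ℕ) (ζ x : ℂ) (g : ℂ[X]) :
    (polarDerivative m ζ g).eval x =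
      g.eval x + (m + 1 : ℂ)⁻¹ * ((ζ - x) * (derivative g).eval x) := by
  simp [polarDerivative]

theorem natDegree_polarDerivative_le {m : ℕ} (ζ : ℂ) {g : ℂ[X]} (hg : g.natDegree ≤ m + 1) :
    (polarDerivative m ζ g).natDegree ≤ m := by
  rw [natDegree_le_iff_coeff_eq_zero]
  intro j hj
  have hm : (m + 1 : ℂ) ≠ 0 := by exact_mod_cast m.succ_ne_zero
  have h1 : g.coeff (j + 1) = 0 := coeff_eq_zero_of_natDegree_lt (by omega)
  rw [coeff_polarDerivative, h1]
  rcases (Nat.succ_le_of_lt hj).eq_or_lt with rfl | h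
  · push_cast
    field_simp
    ring
  · rw [coeff_eq_zero_of_natDegree_lt (by omega)]
    ring

theorem _root_.Multiset.esymm_cons {R : Type*} [CommSemiring R] (a : R) (s : Multiset R) (n : ℕ) :
    (a ::ₘ s).esymm (n + 1) = s.esymm (n + 1) + a * s.esymm n := by
  simp [Multiset.esymm, Multiset.powersetCard_cons, Multiset.sum_map_mul_left]

theorem eval_polarization (m : ℕ) (f : ℂ[X]) (z : Fin m → ℂ) :
    MvPolynomial.eval z (polarization m f) =
      ∑ j ∈ Finset.range (m + 1),
        f.coeff j * ((m.choose j : ℂ))⁻¹ * ((Finset.univ.val.map z).esymm j) := by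
  simp only [polarization, map_sum, map_mul, MvPolynomial.eval_C]
  refine Finset.sum_congr rfl fun j _ => ?_
  rw [← MvPolynomial.aeval_esymm_eq_multiset_esymm (σ := Fin m) (R := ℂ),
    MvPolynomial.aeval_eq_eval]

theorem eval_polarization_cons (m : ℕ) (f : ℂ[X]) (ζ : ℂ) (z : Fin m → ℂ) :
    MvPolynomial.eval (Fin.cons ζ z : Fin (m + 1) → ℂ) (polarization (m + 1) f) =
      MvPolynomial.eval z (polarization m (polarDerivative m ζ f)) := by
  have hu : (Finset.univ.val.map (Fin.cons ζ z : Fin (m + 1) → ℂ)) =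
      ζ ::ₘ Finset.univ.val.map z := by
    simp [Fin.univ_succ, Function.comp_def]
  rw [eval_polarization, eval_polarization, hu]
  set s := Finset.univ.val.map z with hs
  have hcard : s.card = m := by simp [hs]
  have htop : s.esymm (m + 1) = 0 := by
    rw [Multiset.esymm, Multiset.powersetCard_eq_empty _ (by omega)]
    simp
  have hm : (m + 1 : ℂ) ≠ 0 := by exact_mod_cast m.succ_ne_zero
  -- The factors `(m + 1 - j) / (m + 1)` and `(j + 1) / (m + 1)` in the polar derivative's
  -- coefficient convert the binomials of level `m` to level `m + 1`.
  have hsplit : ∀ j ∈ Finset.range (m + 1),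
      (polarDerivative m ζ f).coeff j * ((m.choose j : ℂ))⁻¹ * s.esymm j =
        f.coeff j * (((m + 1).choose j : ℂ))⁻¹ * s.esymm j +
        f.coeff (j + 1) * (((m + 1).choose (j + 1) : ℂ))⁻¹ * (ζ * s.esymm j) := by
    intro j hj
    have hjm : j ≤ m := Nat.lt_succ_iff.mp (Finset.mem_range.mp hj)
    have c0 : (m.choose j : ℂ) ≠ 0 := by exact_mod_cast (Nat.choose_pos hjm).ne'
    have c1 : ((m + 1).choose j : ℂ) ≠ 0 := by
      exact_mod_cast (Nat.choose_pos (hjm.trans m.le_succ)).ne'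
    have c2 : ((m + 1).choose (j + 1) : ℂ) ≠ 0 := by
      exact_mod_cast (Nat.choose_pos (Nat.succ_le_succ hjm)).ne'
    have e2 : ((m : ℂ) + 1) * m.choose j = (m + 1).choose (j + 1) * (j + 1) := by
      exact_mod_cast Nat.add_one_mul_choose_eq m j
    have e1 : ((m : ℂ) + 1) * m.choose j = (m + 1).choose j * (m + 1 - j) := by
      have := Nat.choose_mul_succ_eq m j
      have h' : ((m + 1 - j : ℕ) : ℂ) = m + 1 - j := by
        rw [Nat.cast_sub (hjm.trans m.le_succ)]; push_cast; ring
      rw [← h']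
      exact_mod_cast (mul_comm _ _).trans this
    have i1 : (((m + 1).choose j : ℂ))⁻¹ = (m + 1 - j) * ((m + 1) * m.choose j : ℂ)⁻¹ := by
      rw [e1]
      have : (m + 1 - j : ℂ) ≠ 0 := fun h => by
        rw [h, mul_zero] at e1
        exact mul_ne_zero hm c0 e1
      field_simp
    have i2 : (((m + 1).choose (j + 1) : ℂ))⁻¹ = (j + 1) * ((m + 1) * m.choose j : ℂ)⁻¹ := by
      rw [e2]
      have : (j + 1 : ℂ) ≠ 0 := by exact_mod_cast j.succ_ne_zero
      field_simp
    rw [i1, i2, coeff_polarDerivative]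
    field_simp
    ring
  have hshift : ∑ j ∈ Finset.range (m + 1),
        f.coeff j * (((m + 1).choose j : ℂ))⁻¹ * s.esymm j =
      ∑ j ∈ Finset.range (m + 1),
        f.coeff (j + 1) * (((m + 1).choose (j + 1) : ℂ))⁻¹ * s.esymm (j + 1) + f.coeff 0 := by
    have h := Finset.sum_range_succ'
      (fun j => f.coeff j * (((m + 1).choose j : ℂ))⁻¹ * s.esymm j) (m + 1)
    rw [Finset.sum_range_succ, htop] at h
    simpa [Multiset.esymm] using h
  rw [Finset.sum_congr rfl hsplit, Finset.sum_add_distrib, hshift, Finset.sum_range_succ']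
  simp only [Multiset.esymm_cons, mul_add, Finset.sum_add_distrib]
  simp only [Multiset.esymm, Multiset.powersetCard_zero_left, Multiset.map_singleton,
    Multiset.prod_zero, Multiset.sum_singleton, Nat.choose_zero_right, Nat.cast_one, inv_one,
    mul_one]
  ring

theorem _root_.Multiset.esymm_replicate {R : Type*} [CommSemiring R] (m j : ℕ) (x : R) :
    (Multiset.replicate m x).esymm j = m.choose j * x ^ j := by
  have : ∀ t ∈ (Multiset.replicate m x).powersetCard j, t.prod = x ^ j := by
    intro t ht
    obtain ⟨hle, hc⟩ := Multiset.mem_powersetCard.mp ht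
    rw [Multiset.eq_replicate_card.mpr fun b hb =>
      Multiset.eq_of_mem_replicate (Multiset.mem_of_le hle hb), Multiset.prod_replicate, hc]
  rw [Multiset.esymm, Multiset.map_congr rfl this]
  simp

theorem eval_polarization_diagonal {m : ℕ} {f : ℂ[X]} (hf : f.natDegree ≤ m) (x : ℂ) :
    MvPolynomial.eval (fun _ => x) (polarization m f) = f.eval x := by
  rw [eval_polarization, eval_eq_sum_range' (Nat.lt_succ_of_le hf)]
  refine Finset.sum_congr rfl fun j hj => ?_
  have c0 : (m.choose j : ℂ) ≠ 0 := by
    exact_mod_cast (Nat.choose_pos (Nat.lt_succ_iff.mp (Finset.mem_range.mp hj))).ne'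
  have hr : (Finset.univ : Finset (Fin m)).val.map (fun _ => x) = Multiset.replicate m x := by
    simp
  rw [hr, Multiset.esymm_replicate]
  field_simp

/-! ### Laguerre's and Grace's theorems -/

/-- Laguerre's theorem for an arbitrary set satisfying an averaging condition: the reciprocals
`(x - α)⁻¹`, over the finite zeros `α` and the zeros at infinity, have mean in `K`. -/
theorem eval_polarDerivative_ne_zero {m : ℕ} {g : ℂ[X]} {ζ x : ℂ} {K : Set ℂ}
    (hg : g.natDegree ≤ m + 1) (hx : g.eval x ≠ 0) (hK : Convex ℝ K)
    (hroots : ∀ α, g.eval α = 0 → (x - α)⁻¹ ∈ K)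
    (hinf : g.natDegree < m + 1 → (0 : ℂ) ∈ K) (hζ : x ≠ ζ → (x - ζ)⁻¹ ∉ K) :
    (polarDerivative m ζ g).eval x ≠ 0 := by
  intro h
  rw [eval_polarDerivative] at h
  have hm : (m + 1 : ℂ) ≠ 0 := by exact_mod_cast m.succ_ne_zero
  by_cases hxζ : x = ζ
  · simp [hxζ] at h
    exact hx (hxζ ▸ h)
  refine hζ hxζ ?_
  have hs : g.Splits := IsAlgClosed.splits g
  have hg0 : g ≠ 0 := fun h0 => hx (by simp [h0])
  -- Padding by zeros gives exactly `m + 1` terms without changing the sum, the logarithmic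
  -- derivative of `g` at `x`.
  let s := g.roots.map (fun α => 1 / (x - α)) + Multiset.replicate (m + 1 - g.natDegree) 0
  have hcard : s.card = m + 1 := by
    simp only [s, Multiset.card_add, Multiset.card_map, Multiset.card_replicate,
      ← hs.natDegree_eq_card_roots]
    omega
  have hsum : s.sum = (derivative g).eval x / g.eval x := by
    rw [hs.eval_derivative_div_eval_of_ne_zero hx]
    simp [s]
  have hmem := hK.multiset_average_mem (s := s)
    (fun h0 => by simp [h0] at hcard) (by
      intro u hu
      rcases Multiset.mem_add.mp hu with hu | hu
      · obtain ⟨α, hα, rfl⟩ := Multiset.mem_map.mp hu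
        rw [one_div]
        exact hroots α ((mem_roots hg0).mp hα)
      · obtain ⟨hne, rfl⟩ := Multiset.mem_replicate.mp hu
        exact hinf (by omega))
  rw [hcard, hsum] at hmem
  have hxz : x - ζ ≠ 0 := sub_ne_zero.mpr hxζ
  convert hmem using 1
  push_cast
  field_simp
  field_simp at h
  linear_combination h

/-- Grace's theorem for regions not containing the point at infinity. -/
theorem eval_polarization_ne_zero_of_natDegree_le {A : Set ℂ}
    (hA : ∀ x ∈ A, Convex ℝ {u : ℂ | u = 0 ∨ x - u⁻¹ ∉ A}) :
    ∀ (m : ℕ) (g : ℂ[X]), g.natDegree ≤ m → g ≠ 0 → (∀ x ∈ A, g.eval x ≠ 0) →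
      ∀ z : Fin m → ℂ, (∀ i, z i ∈ A) → MvPolynomial.eval z (polarization m g) ≠ 0 := by
  intro m
  induction m with
  | zero =>
    intro g hg hg0 _ z _
    obtain ⟨a, rfl⟩ := natDegree_eq_zero.mp (Nat.le_zero.mp hg)
    simpa [polarization] using hg0
  | succ m ih =>
    intro g hg hg0 hz z hzA
    have hD : ∀ x ∈ A, (polarDerivative m (z 0) g).eval x ≠ 0 := by
      intro x hx
      refine eval_polarDerivative_ne_zero hg (hz x hx) (hA x hx) (fun α hα => Or.inr ?_)
        (fun _ => Or.inl rfl) (fun hne => ?_)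
      · rw [inv_inv, sub_sub_cancel]
        exact fun hαA => hz α hαA hα
      · simp [sub_ne_zero.mpr hne, hzA 0]
    rw [← Fin.cons_self_tail z, eval_polarization_cons]
    refine ih _ (natDegree_polarDerivative_le _ hg) (fun h0 => hD (z 0) (hzA 0) (by simp [h0]))
      hD _ fun i => hzA _

/-- Grace's theorem for regions containing a neighbourhood of infinity. -/
theorem eval_polarization_ne_zero_of_natDegree_eq {A : Set ℂ} (hAc : Convex ℝ Aᶜ)
    (hA : ∀ x ∈ A, Convex ℝ {u : ℂ | x - u⁻¹ ∉ A}) :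
    ∀ (m : ℕ) (g : ℂ[X]), g.natDegree = m → g ≠ 0 → (∀ x ∈ A, g.eval x ≠ 0) →
      ∀ z : Fin m → ℂ, (∀ i, z i ∈ A) → MvPolynomial.eval z (polarization m g) ≠ 0 := by
  intro m
  induction m with
  | zero =>
    intro g hg hg0 _ z _
    obtain ⟨a, rfl⟩ := natDegree_eq_zero.mp hg
    simpa [polarization] using hg0
  | succ m ih =>
    intro g hg hg0 hz z hzA
    have hD : ∀ x ∈ A, (polarDerivative m (z 0) g).eval x ≠ 0 := by
      intro x hx
      refine eval_polarDerivative_ne_zero hg.le (hz x hx) (hA x hx) (fun α hα => ?_)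
        (fun h => absurd hg h.ne) (fun _ => ?_)
      · show x - _ ∉ A
        rw [inv_inv, sub_sub_cancel]
        exact fun hαA => hz α hαA hα
      · simp [hzA 0]
    have hs : g.Splits := IsAlgClosed.splits g
    have hcard : g.roots.card = m + 1 := by rw [← hs.natDegree_eq_card_roots, hg]
    have hmean := hAc.multiset_average_mem (s := g.roots)
      (fun h0 => by simp [h0] at hcard)
      (fun α hα hαA => hz α hαA ((mem_roots hg0).mp hα))
    have hm : (m + 1 : ℂ) ≠ 0 := by exact_mod_cast m.succ_ne_zero
    have hlead : g.leadingCoeff ≠ 0 := leadingCoeff_ne_zero.mpr hg0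
    have hnext := hs.nextCoeff_eq_neg_sum_roots_mul_leadingCoeff
    rw [nextCoeff_of_natDegree_pos (by omega), hg, Nat.add_sub_cancel] at hnext
    -- The degree drops by exactly one: the top coefficient vanishes only if `z 0` is the mean of
    -- the roots, which lies in the convex complement of `A`.
    have hcoeff : (polarDerivative m (z 0) g).coeff m ≠ 0 := by
      have : (polarDerivative m (z 0) g).coeff m =
          g.leadingCoeff * (z 0 - (m + 1 : ℂ)⁻¹ * g.roots.sum) := by
        rw [coeff_polarDerivative, hnext, leadingCoeff, hg]
        field_simp
        ring
      rw [this]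
      refine mul_ne_zero hlead (sub_ne_zero.mpr fun h => hmean ?_)
      rw [hcard]
      push_cast
      exact h ▸ hzA 0
    rw [← Fin.cons_self_tail z, eval_polarization_cons]
    refine ih _ (le_antisymm (natDegree_polarDerivative_le _ hg.le)
      (le_natDegree_of_ne_zero hcoeff)) (fun h0 => hcoeff (by simp [h0])) hD _ fun i => hzA _

/-! ### Circle forms and convexity under inversion -/

/-- The real quadratic function `a |z|² + p Re z + q Im z + c`. -/
def circleForm (a p q c : ℝ) (z : ℂ) : ℝ :=
  a * Complex.normSq z + p * z.re + q * z.im + c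

theorem convexOn_circleForm {a : ℝ} (ha : 0 ≤ a) (p q c : ℝ) :
    ConvexOn ℝ Set.univ (circleForm a p q c) := by
  refine ⟨convex_univ, fun u _ v _ s t hs ht hst => ?_⟩
  have hs' : s = 1 - t := by linarith
  subst hs'
  have h1 : 0 ≤ a * ((1 - t) * t * ((u.re - v.re) ^ 2 + (u.im - v.im) ^ 2)) := by positivity
  simp only [circleForm, Complex.normSq_apply, Complex.add_re, Complex.add_im, Complex.real_smul,
    Complex.re_ofReal_mul, Complex.im_ofReal_mul, smul_eq_mul]
  linarith

/-- Inversion at `x` carries a circle form to a circle form. -/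
theorem normSq_mul_circleForm_sub_inv (a p q c : ℝ) (x : ℂ) {u : ℂ} (hu : u ≠ 0) :
    Complex.normSq u * circleForm a p q c (x - u⁻¹) =
      circleForm (circleForm a p q c x) (-(2 * a * x.re + p)) (2 * a * x.im + q) a u := by
  have hn : Complex.normSq u ≠ 0 := (Complex.normSq_pos.mpr hu).ne'
  have e : (x - u⁻¹).re = x.re - u.re / Complex.normSq u := by simp [Complex.inv_re]
  have e' : (x - u⁻¹).im = x.im + u.im / Complex.normSq u := by simp [Complex.inv_im, neg_div]
  simp only [circleForm, Complex.normSq_apply (x - u⁻¹), e, e']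
  have hd : u.re ^ 2 + u.im ^ 2 = Complex.normSq u := by rw [Complex.normSq_apply]; ring
  rw [Complex.normSq_apply x]
  field_simp
  linear_combination a * hd

theorem circleForm_sub_inv_nonpos_iff (a p q c : ℝ) (x : ℂ) {u : ℂ} (hu : u ≠ 0) :
    circleForm a p q c (x - u⁻¹) ≤ 0 ↔
      circleForm (circleForm a p q c x) (-(2 * a * x.re + p)) (2 * a * x.im + q) a u ≤ 0 := by
  rw [← normSq_mul_circleForm_sub_inv a p q c x hu,
    mul_nonpos_iff_pos_imp_nonpos]
  have := Complex.normSq_pos.mpr hu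
  constructor
  · exact fun h => ⟨fun _ => h, fun _ => this.le⟩
  · exact fun h => h.1 this

theorem circleForm_sub_inv_neg_iff (a p q c : ℝ) (x : ℂ) {u : ℂ} (hu : u ≠ 0) :
    circleForm a p q c (x - u⁻¹) < 0 ↔
      circleForm (circleForm a p q c x) (-(2 * a * x.re + p)) (2 * a * x.im + q) a u < 0 := by
  rw [← normSq_mul_circleForm_sub_inv a p q c x hu, mul_neg_iff]
  have := Complex.normSq_pos.mpr hu
  simp [this, not_lt.mpr this.le]

theorem circleForm_zero (a p q c : ℝ) : circleForm a p q c 0 = c := by simp [circleForm]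

/-- The inverted form has leading coefficient `circleForm a p q c x`, so membership of `x` in the
region is what makes it convex. Its constant term `a ≤ 0` admits `u = 0`, the image of infinity. -/
theorem convex_inversion_pos {a p q c : ℝ} (ha : a ≤ 0) {x : ℂ}
    (hx : 0 < circleForm a p q c x) :
    Convex ℝ {u : ℂ | u = 0 ∨ x - u⁻¹ ∉ {z | 0 < circleForm a p q c z}} := by
  convert (convexOn_circleForm hx.le (-(2 * a * x.re + p)) (2 * a * x.im + q) a).convex_le 0
    using 1
  ext u
  rcases eq_or_ne u 0 with rfl | hu
  · simp [circleForm_zero, ha]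
  · simp [hu, circleForm_sub_inv_nonpos_iff]

/-- Needed since `F 0 = 0` is possible, as for half-planes: convexity keeps `F` negative on a
segment from `0` to a point where `F < 0`, except perhaps at `0`. -/
theorem convex_insert_zero_lt {F : ℂ → ℝ} (hF : ConvexOn ℝ Set.univ F) (h0 : F 0 ≤ 0) :
    Convex ℝ {u : ℂ | u = 0 ∨ F u < 0} := by
  have key : ∀ (v : ℂ) (s t : ℝ), F v < 0 → 0 ≤ s → 0 ≤ t → s + t = 1 →
      t • v = 0 ∨ F (t • v) < 0 := by
    intro v s t hv hs ht hst
    rcases ht.eq_or_lt with rfl | ht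
    · simp
    · right
      have := hF.2 (Set.mem_univ 0) (Set.mem_univ v) hs ht.le hst
      simp only [smul_zero, zero_add, smul_eq_mul] at this
      nlinarith [mul_nonneg hs (neg_nonneg.mpr h0), mul_pos ht (neg_pos.mpr hv)]
  rintro u (rfl | hu) v (rfl | hv) s t hs ht hst
  · simp
  · simpa using key v s t hv hs ht hst
  · simpa using key u t s hu ht hs (by rwa [add_comm])
  · right
    have := (hF.convex_lt 0) ⟨Set.mem_univ u, hu⟩ ⟨Set.mem_univ v, hv⟩ hs ht hst
    exact this.2

theorem convex_inversion_nonneg {a p q c : ℝ} (ha : a ≤ 0) {x : ℂ}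
    (hx : 0 ≤ circleForm a p q c x) :
    Convex ℝ {u : ℂ | u = 0 ∨ x - u⁻¹ ∉ {z | 0 ≤ circleForm a p q c z}} := by
  convert convex_insert_zero_lt
    (convexOn_circleForm hx (-(2 * a * x.re + p)) (2 * a * x.im + q) a)
    (by rwa [circleForm_zero]) using 1
  ext u
  rcases eq_or_ne u 0 with rfl | hu
  · simp
  · simp [hu, circleForm_sub_inv_neg_iff]

/-- As `0⁻¹ = 0`, the point `u = 0` tests `x` itself and is excluded, in agreement with the constant
term `a > 0`. -/
theorem convex_inversion_pos_of_pos {a p q c : ℝ} (ha : 0 < a) {x : ℂ}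
    (hx : 0 < circleForm a p q c x) :
    Convex ℝ {u : ℂ | x - u⁻¹ ∉ {z | 0 < circleForm a p q c z}} := by
  convert (convexOn_circleForm hx.le (-(2 * a * x.re + p)) (2 * a * x.im + q) a).convex_le 0
    using 1
  ext u
  rcases eq_or_ne u 0 with rfl | hu
  · simp [circleForm_zero, not_le.mpr ha, not_le.mpr hx]
  · simp [circleForm_sub_inv_nonpos_iff _ _ _ _ _ hu]

theorem convex_inversion_nonneg_of_pos {a p q c : ℝ} (ha : 0 < a) {x : ℂ}
    (hx : 0 ≤ circleForm a p q c x) :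
    Convex ℝ {u : ℂ | x - u⁻¹ ∉ {z | 0 ≤ circleForm a p q c z}} := by
  have h : {u : ℂ | x - u⁻¹ ∉ {z | 0 ≤ circleForm a p q c z}} = {u | u ∈ Set.univ ∧
      circleForm (circleForm a p q c x) (-(2 * a * x.re + p)) (2 * a * x.im + q) a u < 0} := by
    ext u
    rcases eq_or_ne u 0 with rfl | hu
    · simp [circleForm_zero, not_lt.mpr ha.le, not_lt.mpr hx]
    · simp [circleForm_sub_inv_neg_iff _ _ _ _ _ hu]
  rw [h]
  exact (convexOn_circleForm hx _ _ _).convex_lt 0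

theorem circleForm_center (ε : ℝ) (c : ℂ) (r : ℝ) (z : ℂ) :
    circleForm ε (-2 * ε * c.re) (-2 * ε * c.im) (ε * (Complex.normSq c - r ^ 2)) z =
      ε * (‖z - c‖ ^ 2 - r ^ 2) := by
  rw [← Complex.normSq_eq_norm_sq]
  simp only [circleForm, Complex.normSq_apply, Complex.sub_re, Complex.sub_im]
  ring

theorem not_convex_of_antipodal {A : Set ℂ} {c w : ℂ} (h1 : c + w ∈ A) (h2 : c - w ∈ A)
    (hc : c ∉ A) : ¬ Convex ℝ A := by
  intro hA
  have := hA h1 h2 (a := 1 / 2) (b := 1 / 2) (by norm_num) (by norm_num) (by norm_num)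
  refine hc ?_
  convert this using 1
  simp only [Complex.real_smul]
  push_cast
  ring

theorem IsCircularRegion.nonempty {A : Set ℂ} (hA : IsCircularRegion A) : A.Nonempty := by
  rcases hA with ⟨c, r, hr, rfl | rfl | rfl | rfl⟩ | ⟨w, t, hw, rfl | rfl⟩
  · exact ⟨c, by simpa using hr⟩
  · exact ⟨c, by simpa using hr.le⟩
  · refine ⟨c + (2 * r : ℝ), ?_⟩
    simp only [Set.mem_ofPred_eq, add_sub_cancel_left, Complex.norm_real, Real.norm_eq_abs]
    rw [abs_of_pos (by positivity)]
    linarith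
  · refine ⟨c + (2 * r : ℝ), ?_⟩
    simp only [Set.mem_ofPred_eq, add_sub_cancel_left, Complex.norm_real, Real.norm_eq_abs]
    rw [abs_of_pos (by positivity)]
    linarith
  · refine ⟨w⁻¹ * (t + 1 : ℝ), ?_⟩
    simp only [Set.mem_ofPred_eq, mul_inv_cancel_left₀ hw, Complex.ofReal_re]
    linarith
  · refine ⟨w⁻¹ * (t + 1 : ℝ), ?_⟩
    simp only [Set.mem_ofPred_eq, mul_inv_cancel_left₀ hw, Complex.ofReal_re]
    linarith

/-- A circular region either excludes the point at infinity, or is the exterior of a circle. -/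
theorem IsCircularRegion.inversion {A : Set ℂ} (hA : IsCircularRegion A) :
    (∀ x ∈ A, Convex ℝ {u : ℂ | u = 0 ∨ x - u⁻¹ ∉ A}) ∨
      (¬ Convex ℝ A ∧ Convex ℝ Aᶜ ∧ ∀ x ∈ A, Convex ℝ {u : ℂ | x - u⁻¹ ∉ A}) := by
  rcases hA with ⟨c, r, hr, rfl | rfl | rfl | rfl⟩ | ⟨w, t, hw, rfl | rfl⟩
  · left
    have : {z : ℂ | ‖z - c‖ < r} = {z | 0 < circleForm (-1) (-2 * (-1) * c.re) (-2 * (-1) * c.im)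
        (-1 * (Complex.normSq c - r ^ 2)) z} := by
      ext z
      simp only [Set.mem_ofPred_eq, circleForm_center, ← sq_lt_sq₀ (norm_nonneg (z - c)) hr.le]
      constructor <;> intro h <;> linarith
    rw [this]
    exact fun x hx => convex_inversion_pos (by norm_num) hx
  · left
    have : {z : ℂ | ‖z - c‖ ≤ r} = {z | 0 ≤ circleForm (-1) (-2 * (-1) * c.re) (-2 * (-1) * c.im)
        (-1 * (Complex.normSq c - r ^ 2)) z} := by
      ext z
      simp only [Set.mem_ofPred_eq, circleForm_center, ← sq_le_sq₀ (norm_nonneg (z - c)) hr.le]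
      constructor <;> intro h <;> linarith
    rw [this]
    exact fun x hx => convex_inversion_nonneg (by norm_num) hx
  · right
    refine ⟨not_convex_of_antipodal (c := c) (w := (2 * r : ℝ)) ?_ ?_ ?_, ?_, ?_⟩
    · simp [abs_of_pos hr]; linarith
    · simp [abs_of_pos hr]; linarith
    · simp [hr.le]
    · have h : {z : ℂ | r < ‖z - c‖}ᶜ = Metric.closedBall c r := by
        ext z
        simp [dist_eq_norm]
      rw [h]
      exact convex_closedBall c r
    have : {z : ℂ | r < ‖z - c‖} = {z | 0 < circleForm 1 (-2 * 1 * c.re) (-2 * 1 * c.im)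
        (1 * (Complex.normSq c - r ^ 2)) z} := by
      ext z
      simp only [Set.mem_ofPred_eq, circleForm_center, ← sq_lt_sq₀ hr.le (norm_nonneg (z - c))]
      constructor <;> intro h <;> linarith
    rw [this]
    exact fun x hx => convex_inversion_pos_of_pos one_pos hx
  · right
    refine ⟨not_convex_of_antipodal (c := c) (w := (2 * r : ℝ)) ?_ ?_ ?_, ?_, ?_⟩
    · simp [abs_of_pos hr]; linarith
    · simp [abs_of_pos hr]; linarith
    · simp [hr]
    · have h : {z : ℂ | r ≤ ‖z - c‖}ᶜ = Metric.ball c r := by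
        ext z
        simp [dist_eq_norm]
      rw [h]
      exact convex_ball c r
    have : {z : ℂ | r ≤ ‖z - c‖} = {z | 0 ≤ circleForm 1 (-2 * 1 * c.re) (-2 * 1 * c.im)
        (1 * (Complex.normSq c - r ^ 2)) z} := by
      ext z
      simp only [Set.mem_ofPred_eq, circleForm_center, ← sq_le_sq₀ hr.le (norm_nonneg (z - c))]
      constructor <;> intro h <;> linarith
    rw [this]
    exact fun x hx => convex_inversion_nonneg_of_pos one_pos hx
  · left
    have : {z : ℂ | t < (w * z).re} = {z | 0 < circleForm 0 w.re (-w.im) (-t) z} := by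
      ext z
      simp only [Set.mem_ofPred_eq, circleForm, Complex.mul_re]
      constructor <;> intro h <;> linarith
    rw [this]
    exact fun x hx => convex_inversion_pos le_rfl hx
  · left
    have : {z : ℂ | t ≤ (w * z).re} = {z | 0 ≤ circleForm 0 w.re (-w.im) (-t) z} := by
      ext z
      simp only [Set.mem_ofPred_eq, circleForm, Complex.mul_re]
      constructor <;> intro h <;> linarith
    rw [this]
    exact fun x hx => convex_inversion_nonneg le_rfl hx

/-! ### Coincidence theorem and stability -/

theorem polarization_sub_C (m : ℕ) (f : ℂ[X]) (a : ℂ) (z : Fin m → ℂ) :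
    MvPolynomial.eval z (polarization m (f - C a)) =
      MvPolynomial.eval z (polarization m f) - a := by
  simp only [eval_polarization, coeff_sub, sub_mul, Finset.sum_sub_distrib]
  congr 1
  rw [Finset.sum_range_succ']
  simp [coeff_C, Multiset.esymm]

/-- The Grace–Walsh–Szegő coincidence theorem. -/
theorem grace_walsh_szego {m : ℕ} {f : ℂ[X]} (hf : f.natDegree ≤ m) {A : Set ℂ}
    (hA : IsCircularRegion A) (h : f.natDegree = m ∨ Convex ℝ A) {z : Fin m → ℂ}
    (hz : ∀ i, z i ∈ A) :
    ∃ w ∈ A, MvPolynomial.eval z (polarization m f) = f.eval w := by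
  set b := MvPolynomial.eval z (polarization m f) with hb
  have hpol : MvPolynomial.eval z (polarization m (f - C b)) = 0 := by
    rw [polarization_sub_C, hb, sub_self]
  by_contra! hcon
  have hzero : ∀ x ∈ A, (f - C b).eval x ≠ 0 := by
    intro x hx h0
    rw [eval_sub, eval_C, sub_eq_zero] at h0
    exact hcon x hx h0.symm
  obtain ⟨x, hx⟩ := hA.nonempty
  have hne : f - C b ≠ 0 := fun h0 => hzero x hx (by simp [h0])
  rcases hA.inversion with hi | ⟨hnc, hc, hi⟩
  · exact eval_polarization_ne_zero_of_natDegree_le hi m _ (by simpa using hf) hne hzero z hz hpol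
  -- A non-convex region forces degree exactly `m`, which subtracting a constant preserves.
  · exact eval_polarization_ne_zero_of_natDegree_eq hc hi m _
      (by simpa using h.resolve_right hnc) hne hzero z hz hpol

theorem isCircularRegion_upperHalfPlane : IsCircularRegion {z : ℂ | 0 < z.im} :=
  Or.inr ⟨-Complex.I, 0, by simp, Or.inl (by ext z; simp)⟩

theorem isMvStable_polarization_iff {m : ℕ} {f : ℂ[X]} (hf : f.natDegree ≤ m) :
    IsMvStable (polarization m f) ↔ IsStable f := by
  constructor
  · rintro (h | h)
    · exact Or.inl (funext fun x => by rw [← eval_polarization_diagonal hf x, h]; simp)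
    · exact Or.inr fun x hx => eval_polarization_diagonal hf x ▸ h (fun _ => x) fun _ => hx
  · rintro (rfl | h)
    · exact Or.inl (by simp [polarization])
    · refine Or.inr fun z hz => ?_
      obtain ⟨w, hw, e⟩ := grace_walsh_szego hf isCircularRegion_upperHalfPlane
        (Or.inr (convex_halfSpace_im_gt 0)) hz
      rw [e]
      exact h w hw

end GWS

theorem theorem4p1 (m : ℕ) (f : Polynomial ℂ) (hf : f.natDegree ≤ m) :
    (∀ A : Set ℂ, GWS.IsCircularRegion A → (f.natDegree = m ∨ Convex ℝ A) →
      ∀ z : Fin m → ℂ, (∀ i, z i ∈ A) →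
        ∃ w ∈ A, MvPolynomial.eval z (GWS.polarization m f) = f.eval w) ∧
    (GWS.IsMvStable (GWS.polarization m f) ↔ GWS.IsStable f) :=
  ⟨fun _ hA h _ hz => GWS.grace_walsh_szego hf hA h hz, GWS.isMvStable_polarization_iff hf⟩
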